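/- Let $m,n,k\ge 0$ be integers and let arrays have entries in a totally ordered set, where equal entries are ordered by their positions (lexicographically, row first, in the case of an $m\times n$ array). The sorted 2-sided Top-$k$ query $(i,j)$ on a 1D array $A[1\dots n]$ asks for the list of the positions of the $k$ largest entries of $A[i\dots j]$, in decreasing order of their entries; the sorted 4-sided Top-$k$ query $(i,j,a,b)$ on an $m\times n$ array $A$ asks for the same list for the subarray $A[i\dots j][a\dots b]$ (if a range has fewer than $k$ positions, all of them are listed). A $b$-bit encoding of a class of arrays supporting a family of queries assigns to each array a string of $b$ bits from which, without access to the array, every query can be answered. (1) If there is an $S(n,k)$-bit encoding of the 1D arrays of size $n$ supporting sorted 2-sided Top-$k$ queries, then there is an encoding of the $m\times n$ arrays $A$ in $m\,S(n,k)+2nm(m-1)$ bits supporting sorted 4-sided Top-$k$ queries on $A$. (2) Moreover, there is an encoding of the $m\times n$ arrays supporting sorted 4-sided Top-$k$ queries in at most $m\lg\binom{(k+1)n}{n}+2nm(m-1)+o(n)$ bits, where $\lg=\log_2$ and the $o(n)$ term depends only on $n$. -/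

import Mathlib

/-- The answer to the sorted Top-`k` query on the range `R` of the array `A` (whose positions form
the linear order `ι`): the positions of the `k` largest entries of `A` in `R`, the position of the
largest entry first. Equal entries are ordered by their positions. If `R` has fewer than `k`
positions, all of them are reported. -/
def topK {ι α : Type*} [LinearOrder ι] [LinearOrder α] (k : ℕ) (A : ι → α) (R : Finset ι) :
    List ι :=
  (((R.image fun p => toLex (A p, p)).sort (· ≥ ·)).take k).map fun e => (ofLex e).2

/-- The sorted 2-sided Top-`k` query on a 1D array of size `n`; the query `(i, j)` asks for the
range `A[i..j]`. -/
def topK2Sided {α : Type*} [LinearOrder α] (n k : ℕ) (A : Fin n → α) (q : Fin n × Fin n) :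
    List (Fin n) :=
  topK k A (Finset.Icc q.1 q.2)

/-- The sorted 4-sided Top-`k` query on an `m × n` array; the query `((i, j), (a, b))` asks for the
range `A[i..j][a..b]`. Positions are ordered lexicographically (row first). -/
def topK4Sided {α : Type*} [LinearOrder α] (m n k : ℕ) (A : Fin m → Fin n → α)
    (q : (Fin m × Fin m) × (Fin n × Fin n)) : List (Fin m × Fin n) :=
  (topK k (fun p : Fin m ×ₗ Fin n => A (ofLex p).1 (ofLex p).2)
    ((Finset.Icc q.1.1 q.1.2 ×ˢ Finset.Icc q.2.1 q.2.2).image toLex)).map ofLex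

/-- There is a `b`-bit encoding of the objects `x : X` supporting the queries `answer`: every `x` is
encoded in `b` bits, and each query is answered from these bits alone, without access to `x`. -/
def HasEncoding {X Q R : Type*} (answer : X → Q → R) (b : ℕ) : Prop :=
  ∃ (encode : X → (Fin b → Bool)) (decode : (Fin b → Bool) → Q → R),
    ∀ (x : X) (q : Q), decode (encode x) q = answer x q

/-!
Entries are made distinct by appending their positions; the sorted Top-`k` list of a range then
carries the same information as the ranks of its positions, truncated at `k` (`topK_eq_topK_iff`).

Two rows. Let the Top-`k` lists of two rows be known. To list the `k` largest entries of a range of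
columns, the two sorted rows are merged; the comparisons made during the merge take place, already
on the smallest range containing both columns, between entries that form a *contest*
(`IsContest`). Whether two entries form a contest depends only on the Top-`k` lists of the rows and
on the contests between larger entries (`IsContest.transfer`), so the contests can be decided one
after another in decreasing order of the entries, and only outcomes that are not implied by earlier
ones cost a bit (`exists_encoding_of_card_branches_le`). Charge such a bit to the winner of the
contest and to the side of the winner on which the loser lies. In a contest, an entry of the loser's
row that exceeds the loser also exceeds the winner. Hence if the same winner beats two entries on
the same side, the farther one is the larger, so that contest is decided first and settles the
nearer one. Each of the `2 * n` entries is thus charged at most once for each side, and `4 * n` bits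
suffice (`exists_contest_encoding`).

An `m × n` array. A Top-`k` entry of a 4-sided range exceeds an entry of another row if and only if
this follows from a contest between these two rows (`exists_isContest`). The codes of the rows and
`4 * n` bits for each of the `m * (m - 1) / 2` pairs of rows therefore answer all queries
(`exists_array_code`), which is the first claim.

The second claim needs a row code with at most `((k + 1) * n).choose n` values. When a row is read
from left to right, call an entry active while fewer than `k` of the later entries exceed it. The
active entries are the only ones that matter for ranges ending at the current position, and a new
entry is located among them by the number of active entries it exceeds. These `n` numbers have sum
at most `k * n`, since an entry is no longer active after `k` larger ones, and there are
`((k + 1) * n).choose n` such sequences (`exists_row_code`, `card_sym_option_fin`). As the bound on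
the number of values is exact, only one rounding to whole bits occurs for the whole array, and the
error term `1` serves as `o(n)`.
-/

open Finset

/-! ### Ranks and Top-`k` lists -/

/-- The number of positions of `R` whose `f`-value exceeds that of `p`, so that the largest entry
has rank `0`. -/
def rankIn {ι β : Type*} [LinearOrder β] (f : ι → β) (R : Finset ι) (p : ι) : ℕ :=
  #{q ∈ R | f p < f q}

section Rank

variable {ι β : Type*} [LinearOrder β] {f f' : ι → β} {R R' : Finset ι} {p q : ι} {k : ℕ}

lemma rankIn_mono (h : R ⊆ R') : rankIn f R p ≤ rankIn f R' p :=
  card_le_card (filter_subset_filter _ h)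

lemma rankIn_anti (h : f p ≤ f q) : rankIn f R q ≤ rankIn f R p :=
  card_le_card fun x hx => by
    rw [mem_filter] at hx ⊢
    exact ⟨hx.1, h.trans_lt hx.2⟩

lemma rankIn_lt (hq : q ∈ R) (h : f p < f q) : rankIn f R q < rankIn f R p :=
  card_lt_card <| (ssubset_iff_of_subset fun x hx => by
    rw [mem_filter] at hx ⊢
    exact ⟨hx.1, h.trans hx.2⟩).2 ⟨q, by simp [hq, h]⟩

lemma lt_of_rankIn_lt (h : rankIn f R q < rankIn f R p) : f p < f q :=
  lt_of_not_ge fun h' => h.not_ge (rankIn_anti h')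

/-- `f` and `f'` have the same sorted Top-`k` list on `R`, expressed through ranks: the ranks
truncated at `k` coincide. -/
def SameTop (k : ℕ) (f f' : ι → β) (R : Finset ι) : Prop :=
  ∀ p ∈ R, min (rankIn f R p) k = min (rankIn f' R p) k

lemma SameTop.symm (h : SameTop k f f' R) : SameTop k f' f R := fun p hp => (h p hp).symm

lemma SameTop.trans {f'' : ι → β} (h : SameTop k f f' R) (h' : SameTop k f' f'' R) :
    SameTop k f f'' R := fun p hp => (h p hp).trans (h' p hp)

lemma SameTop.rankIn_eq (h : SameTop k f f' R) (hp : p ∈ R) (hk : rankIn f R p < k) :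
    rankIn f' R p = rankIn f R p := by
  have := h p hp
  omega

/-- Entries above a Top-`k` entry are recognised from the Top-`k` list. -/
lemma SameTop.lt_of_gt (h : SameTop k f f' R) (hp : p ∈ R) (hq : q ∈ R) (hk : rankIn f R p < k)
    (hlt : f p < f q) : f' p < f' q := by
  have h1 := h p hp
  have h2 := h q hq
  have h3 := rankIn_lt hq hlt
  exact lt_of_rankIn_lt (R := R) (by omega)

/-- Entries below a Top-`k` entry are recognised from the Top-`k` list. -/
lemma SameTop.lt_of_lt (h : SameTop k f f' R) (hp : p ∈ R) (hq : q ∈ R) (hk : rankIn f R p < k)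
    (hlt : f q < f p) : f' q < f' p := by
  have h1 := h p hp
  have h2 := h q hq
  have h3 := rankIn_lt hp hlt
  exact lt_of_rankIn_lt (R := R) (by omega)

lemma SameTop.le_of_le (h : SameTop k f f' R) (hf : Function.Injective f) (hp : p ∈ R)
    (hq : q ∈ R) (hk : rankIn f R p < k) (hle : f q ≤ f p) : f' q ≤ f' p := by
  rcases hle.lt_or_eq with hlt | heq
  · exact (h.lt_of_lt hp hq hk hlt).le
  · rw [hf heq]

/-- If the order relations downwards from each Top-`k` entry are the same for `f` and `f'`, then
so are the Top-`k` lists. -/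
lemma sameTop_of_lt_imp (hf : Function.Injective f) (hf' : Function.Injective f')
    (h : ∀ p ∈ R, rankIn f R p < k → ∀ q ∈ R, f q < f p → f' q < f' p)
    (h' : ∀ p ∈ R, rankIn f' R p < k → ∀ q ∈ R, f' q < f' p → f q < f p) :
    SameTop k f f' R := by
  have key : ∀ {g g' : ι → β}, Function.Injective g →
      (∀ p ∈ R, rankIn g R p < k → ∀ q ∈ R, g q < g p → g' q < g' p) →
      ∀ p ∈ R, rankIn g R p < k → rankIn g' R p = rankIn g R p := by
    intro g g' hg hgg p hp hk
    refine congrArg card (filter_congr fun q hq => ⟨fun hlt => ?_, fun hlt => ?_⟩)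
    · by_contra hcon
      rcases (not_lt.1 hcon).lt_or_eq with h1 | h1
      · exact lt_asymm hlt (hgg p hp hk q hq h1)
      · rw [hg h1] at hlt
        exact lt_irrefl _ hlt
    · exact hgg q hq ((rankIn_lt hq hlt).trans hk) p hp hlt
  intro p hp
  have h1 := key hf h p hp
  have h2 := key hf' h' p hp
  omega

end Rank

lemma countP_lt_getElem {β : Type*} [LinearOrder β] {l : List β} (hl : l.Pairwise (· > ·))
    {i : ℕ} (hi : i < l.length) : l.countP (fun x => l[i] < x) = i := by
  induction l generalizing i with
  | nil => simp at hi
  | cons a t ih =>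
    rw [List.pairwise_cons] at hl
    cases i with
    | zero =>
      rw [List.countP_eq_zero]
      intro x hx
      rcases List.mem_cons.1 hx with rfl | hx
      · simp
      · simpa using (hl.1 x hx).le
    | succ i =>
      have hi' : i < t.length := by simpa using hi
      rw [List.countP_cons]
      simp only [List.getElem_cons_succ]
      rw [ih hl.2 hi']
      simpa using hl.1 _ (List.getElem_mem hi')

lemma getElem?_sort_ge_eq_some_iff {β : Type*} [LinearOrder β] (s : Finset β) (i : ℕ) (e : β) :
    (s.sort (· ≥ ·))[i]? = some e ↔ e ∈ s ∧ #{x ∈ s | e < x} = i := by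
  have hpw : (s.sort (· ≥ ·)).Pairwise (· > ·) := s.sortedGT_sort.pairwise
  have hcard : ∀ e, #{x ∈ s | e < x} = (s.sort (· ≥ ·)).countP (fun x => e < x) := by
    intro e
    conv_lhs => rw [← s.sort_toFinset (· ≥ ·)]
    rw [List.filter_toFinset, List.toFinset_card_of_nodup ((s.sort_nodup _).filter _),
      List.countP_eq_length_filter]
  constructor
  · intro h
    obtain ⟨hi, rfl⟩ := List.getElem?_eq_some_iff.1 h
    exact ⟨(s.mem_sort (· ≥ ·)).1 (List.getElem_mem hi), by rw [hcard, countP_lt_getElem hpw hi]⟩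
  · rintro ⟨he, hi⟩
    obtain ⟨j, hj, rfl⟩ := List.getElem_of_mem ((s.mem_sort (· ≥ ·)).2 he)
    rw [hcard, countP_lt_getElem hpw hj] at hi
    subst hi
    simp

/-- The entries of `A`, made distinct by appending their positions. -/
def tagged {ι α : Type*} (A : ι → α) (p : ι) : α ×ₗ ι := toLex (A p, p)

lemma tagged_injective {ι α : Type*} (A : ι → α) : Function.Injective (tagged A) := fun _ _ h =>
  congrArg (fun e => (ofLex e).2) h

section TopK

variable {ι α : Type*} [LinearOrder ι] [LinearOrder α]

lemma getElem?_topK_eq_some_iff (k : ℕ) (A : ι → α) (R : Finset ι) (i : ℕ) (p : ι) :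
    (topK k A R)[i]? = some p ↔ i < k ∧ p ∈ R ∧ rankIn (tagged A) R p = i := by
  have hrank : ∀ p, #{x ∈ R.image (tagged A) | tagged A p < x} = rankIn (tagged A) R p := by
    intro p
    rw [filter_image, card_image_of_injective _ (tagged_injective A), rankIn]
  have hunf : topK k A R =
    (((R.image (tagged A)).sort (· ≥ ·)).take k).map fun e => (ofLex e).2 := rfl
  rw [hunf, List.getElem?_map, Option.map_eq_some_iff]
  constructor
  · rintro ⟨e, he, rfl⟩
    rw [List.getElem?_take] at he
    split_ifs at he with hik
    obtain ⟨he, hi⟩ := (getElem?_sort_ge_eq_some_iff _ _ _).1 he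
    obtain ⟨p, hp, rfl⟩ := mem_image.1 he
    exact ⟨hik, hp, (hrank p).symm.trans hi⟩
  · rintro ⟨hik, hp, hi⟩
    refine ⟨tagged A p, ?_, rfl⟩
    rw [List.getElem?_take, if_pos hik, getElem?_sort_ge_eq_some_iff, hrank]
    exact ⟨mem_image_of_mem _ hp, hi⟩

lemma topK_eq_topK_iff (k : ℕ) (A A' : ι → α) (R : Finset ι) :
    topK k A R = topK k A' R ↔ SameTop k (tagged A) (tagged A') R := by
  constructor
  · intro h p hp
    have h1 := getElem?_topK_eq_some_iff k A R (rankIn (tagged A) R p) p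
    have h2 := getElem?_topK_eq_some_iff k A' R (rankIn (tagged A) R p) p
    have h3 := getElem?_topK_eq_some_iff k A R (rankIn (tagged A') R p) p
    have h4 := getElem?_topK_eq_some_iff k A' R (rankIn (tagged A') R p) p
    rw [h] at h1 h3
    simp only [hp, true_and, and_true] at h1 h2 h3 h4
    have h5 := h1.symm.trans h2
    have h6 := h3.symm.trans h4
    omega
  · intro h
    refine List.ext_getElem? fun i => Option.ext fun p => ?_
    rw [getElem?_topK_eq_some_iff, getElem?_topK_eq_some_iff]
    refine and_congr_right fun hik => and_congr_right fun hp => ?_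
    have := h p hp
    omega

end TopK

/-! ### Encoding the outcomes of comparisons made one after another -/

/-- Along the order of `key`, the outcome of question `i` on `x` is not determined by the outcomes
of the questions with smaller key: some `x'` over the same base point shares them and differs on
question `i`. -/
def Branches {X Y ι : Type*} (base : X → Y) (key : Y → ι → ℕ) (c : ι → X → Prop) (x : X) (i : ι) :
    Prop :=
  ∃ x', base x' = base x ∧ (∀ i', key (base x) i' < key (base x) i → (c i' x' ↔ c i' x)) ∧
    ¬(c i x' ↔ c i x)

lemma Branches.congr {X Y ι : Type*} {base : X → Y} {key : Y → ι → ℕ} {c : ι → X → Prop}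
    {x x' : X} {i : ι} (hbase : base x = base x')
    (hpast : ∀ i', key (base x) i' < key (base x) i → (c i' x ↔ c i' x'))
    (h : Branches base key c x i) : Branches base key c x' i := by
  obtain ⟨y, hy, hpast', hne⟩ := h
  by_cases hc : c i x ↔ c i x'
  · exact ⟨y, hy.trans hbase, fun i' hi' => (hpast' i' (hbase ▸ hi')).trans
      (hpast i' (hbase ▸ hi')), fun h => hne (h.trans hc.symm)⟩
  · exact ⟨x, hbase, fun i' hi' => hpast i' (hbase ▸ hi'), hc⟩

/-- Yes/no questions are asked in the order of `key`, which may depend on the base point. If at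
most `B` of them branch at each `x`, then `B` bits determine all outcomes once the base point is
known: record the outcomes of the branching questions only, in the order in which they are asked. -/
theorem exists_encoding_of_card_branches_le {X Y ι : Type*} [Fintype ι] (base : X → Y)
    (key : Y → ι → ℕ) (c : ι → X → Prop) (B : ℕ)
    (hB : ∀ x, {i | Branches base key c x i}.ncard ≤ B) :
    ∃ enc : X → (Fin B → Bool), ∀ x x', base x = base x' → enc x = enc x' →
      ∀ i, c i x ↔ c i x' := by
  classical
  -- Ties between keys are broken by an arbitrary enumeration of the questions.
  let e := Fintype.equivFin ι
  let N := Fintype.card ι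
  let ord : Y → ι → ℕ := fun y i => key y i * N + e i
  have ord_inj : ∀ y, Function.Injective (ord y) := by
    intro y i i' h
    have h1 : (ord y i) % N = (ord y i') % N := by rw [h]
    simp only [ord, Nat.mul_add_mod_self_right, Nat.mod_eq_of_lt (e i).2,
      Nat.mod_eq_of_lt (e i').2, N] at h1
    exact e.injective (Fin.ext h1)
  have ord_lt : ∀ y i i', key y i < key y i' → ord y i < ord y i' := by
    intro y i i' h
    have h1 : (key y i + 1) * N ≤ key y i' * N := Nat.mul_le_mul_right _ h
    have h2 : (e i : ℕ) < N := (e i).2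
    simp only [ord]
    rw [add_mul] at h1
    omega
  let cnt : X → ι → ℕ := fun x i =>
    #{i' | ord (base x) i' < ord (base x) i ∧ Branches base key c x i'}
  have cnt_lt : ∀ x i, Branches base key c x i → cnt x i < B := by
    intro x i hi
    refine lt_of_lt_of_le ?_ (hB x)
    rw [Set.ncard_eq_toFinset_card']
    refine card_lt_card <| (ssubset_iff_of_subset fun i' hi' => ?_).2 ⟨i, by simpa using hi, ?_⟩
    · simpa using (mem_filter.1 hi').2.2
    · simp
  have cnt_strict : ∀ x i i', Branches base key c x i → ord (base x) i < ord (base x) i' →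
      cnt x i < cnt x i' := by
    intro x i i' hi hlt
    refine card_lt_card <| (ssubset_iff_of_subset fun j hj => ?_).2 ⟨i, ?_, ?_⟩
    · simp only [mem_filter, mem_univ, true_and] at hj ⊢
      exact ⟨hj.1.trans hlt, hj.2⟩
    · simpa using ⟨hlt, hi⟩
    · simp
  have cnt_inj : ∀ x i i', Branches base key c x i → Branches base key c x i' →
      cnt x i = cnt x i' → i = i' := by
    intro x i i' hi hi' h
    rcases lt_trichotomy (ord (base x) i) (ord (base x) i') with hlt | heq | hlt
    · exact absurd h (cnt_strict x i i' hi hlt).ne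
    · exact ord_inj _ heq
    · exact absurd h (cnt_strict x i' i hi' hlt).ne'
  let enc : X → (Fin B → Bool) := fun x p =>
    decide (∃ i, Branches base key c x i ∧ cnt x i = p ∧ c i x)
  have enc_cnt : ∀ x i (hi : Branches base key c x i),
      enc x ⟨cnt x i, cnt_lt x i hi⟩ = true ↔ c i x := by
    intro x i hi
    simp only [enc, decide_eq_true_eq]
    constructor
    · rintro ⟨i', hi', hcnt, hc⟩
      rwa [← cnt_inj x i' i hi' hi hcnt]
    · exact fun hc => ⟨i, hi, rfl, hc⟩
  refine ⟨enc, fun x x' hbase henc => ?_⟩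
  suffices H : ∀ t i, ord (base x) i = t → (c i x ↔ c i x') from fun i => H _ i rfl
  intro t
  induction t using Nat.strong_induction_on with
  | _ t ih =>
    rintro i rfl
    have hbr : ∀ i', ord (base x) i' ≤ ord (base x) i →
        (Branches base key c x i' ↔ Branches base key c x' i') := by
      intro i' hi'
      have hpast : ∀ j, key (base x) j < key (base x) i' → (c j x ↔ c j x') := fun j hj =>
        ih _ ((ord_lt _ j i' hj).trans_le hi') j rfl
      exact ⟨Branches.congr hbase hpast,
        Branches.congr hbase.symm fun j hj => (hpast j (hbase ▸ hj)).symm⟩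
    by_cases hi : Branches base key c x i
    · have hi' := (hbr i le_rfl).1 hi
      have hcnt : cnt x i = cnt x' i := by
        refine congrArg card (filter_congr fun j _ => ?_)
        rw [← hbase]
        exact and_congr_right fun hj => hbr j hj.le
      have h1 := enc_cnt x i hi
      have h2 := enc_cnt x' i hi'
      have h3 : enc x ⟨cnt x i, cnt_lt x i hi⟩ = enc x' ⟨cnt x' i, cnt_lt x' i hi'⟩ := by
        rw [henc]
        exact congrArg _ (Fin.ext hcnt)
      rw [← h1, ← h2, h3]
    · by_contra hne
      exact hi ⟨x', hbase.symm, fun i' hi' => (ih _ (ord_lt _ i' i hi') i' rfl).symm,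
        fun h => hne h.symm⟩

/-! ### Contests between two rows -/

section Contest

variable {β : Type*} [LinearOrder β] {n k : ℕ}

/-- The entries `f j` and `g l` of two rows form a contest: merging the two sorted rows on the
smallest column range containing `j` and `l` leads, before `k` entries are listed, to the comparison
of `f j` with `g l`. -/
def IsContest (k : ℕ) (f g : Fin n → β) (j l : Fin n) : Prop :=
  rankIn f (uIcc j l) j + rankIn g (uIcc j l) l < k ∧
    (∀ j' ∈ uIcc j l, f j < f j' → g l < f j') ∧ ∀ l' ∈ uIcc j l, g l < g l' → f j < g l'

lemma IsContest.symm {f g : Fin n → β} {j l : Fin n} (h : IsContest k f g j l) :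
    IsContest k g f l j := by
  obtain ⟨h1, h2, h3⟩ := h
  rw [uIcc_comm] at h1 h2 h3
  exact ⟨by omega, h3, h2⟩

/-- If `f j` is among the `k` largest entries of two rows on `[a, b]`, then `f j` beats every
smaller entry `g l` as a consequence of a contest: the one with the largest entry of `g` below
`f j`. -/
lemma exists_isContest {f g : Fin n → β} (hd : ∀ j l, f j ≠ g l) {a b j l : Fin n}
    (hj : j ∈ Icc a b) (hl : l ∈ Icc a b) (hlt : g l < f j)
    (hk : rankIn f (Icc a b) j + #{l' ∈ Icc a b | f j < g l'} < k) :
    ∃ m ∈ Icc a b, g l ≤ g m ∧ g m < f j ∧ rankIn g (Icc a b) m < k ∧ IsContest k f g j m := by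
  obtain ⟨m, hm, hmax⟩ := exists_max_image {l' ∈ Icc a b | g l' < f j} g ⟨l, by simp_all⟩
  rw [mem_filter] at hm
  have habove : ∀ l' ∈ Icc a b, g m < g l' → f j < g l' := by
    intro l' hl' h
    refine lt_of_not_ge fun h' => h.not_ge (hmax l' (mem_filter.2 ⟨hl', ?_⟩))
    exact h'.lt_of_ne fun h => hd _ _ h.symm
  have hrank : rankIn g (Icc a b) m ≤ #{l' ∈ Icc a b | f j < g l'} :=
    card_le_card fun l' hl' => by
      rw [mem_filter] at hl' ⊢
      exact ⟨hl'.1, habove l' hl'.1 hl'.2⟩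
  have hsub : uIcc j m ⊆ Icc a b := uIcc_subset_Icc hj hm.1
  have h1 : rankIn f (uIcc j m) j ≤ _ := rankIn_mono hsub
  have h2 : rankIn g (uIcc j m) m ≤ _ := rankIn_mono hsub
  exact ⟨m, hm.1, hmax l (mem_filter.2 ⟨hl, hlt⟩), hm.2, by omega, by omega,
    fun j' _ h => hm.2.trans h, fun l' hl' h => habove l' (hsub hl') h⟩

/-- In a contest between `f j` and `g l`, the entries of the first row above `f j` lie above `g l`;
this is certified by the Top-`k` lists of the rows and the outcomes of the contests between larger
entries. -/
lemma IsContest.lt_of_lt {f g f' g' : Fin n → β} {j l : Fin n} (h : IsContest k f g j l)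
    (hg : Function.Injective g) (hd : ∀ j l, f j ≠ g l)
    (hff : ∀ a b, SameTop k f f' (Icc a b)) (hgg : ∀ a b, SameTop k g g' (Icc a b))
    (H : ∀ j' ∈ uIcc j l, ∀ l' ∈ uIcc j l, f j ≤ f j' → g l ≤ g l' → j' ≠ j ∨ l' ≠ l →
      IsContest k f g j' l' → g l' < f j' → g' l' < f' j') :
    ∀ j' ∈ uIcc j l, f' j < f' j' → g' l < f' j' := by
  obtain ⟨h1, h2, -⟩ := h
  have hI : uIcc j l = Icc (j ⊓ l) (j ⊔ l) := rfl
  have hff := hff (j ⊓ l) (j ⊔ l)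
  have hgg := hgg (j ⊓ l) (j ⊔ l)
  rw [← hI] at hff hgg
  intro j' hj' hlt'
  have hjk : rankIn f (uIcc j l) j < k := by omega
  have hlt : f j < f j' :=
    hff.symm.lt_of_gt left_mem_uIcc hj' (by rwa [hff.rankIn_eq left_mem_uIcc hjk]) hlt'
  have hl := h2 j' hj' hlt
  have h3 := rankIn_lt hj' hlt
  have h4 : #{l' ∈ uIcc j l | f j' < g l'} ≤ rankIn g (uIcc j l) l := card_le_card fun l' hl' => by
    rw [mem_filter] at hl' ⊢
    exact ⟨hl'.1, hl.trans hl'.2⟩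
  obtain ⟨m, hm, hlm, hmj, hmk, hcon⟩ := exists_isContest (k := k) hd (hI ▸ hj')
    (hI ▸ right_mem_uIcc) hl (by rw [← hI]; omega)
  rw [← hI] at hm hmk
  have hne : j' ≠ j := by
    rintro rfl
    exact lt_irrefl _ hlt
  exact (hgg.le_of_le hg hm right_mem_uIcc hmk hlm).trans_lt
    (H j' hj' m hm hlt.le hlm (Or.inl hne) hcon hmj)

/-- Whether `f j` and `g l` form a contest is determined by the Top-`k` lists of the rows and the
outcomes of the contests between larger entries. -/
lemma IsContest.transfer {f g f' g' : Fin n → β} {j l : Fin n} (h : IsContest k f g j l)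
    (hf : Function.Injective f) (hg : Function.Injective g) (hd : ∀ j l, f j ≠ g l)
    (hff : ∀ a b, SameTop k f f' (Icc a b)) (hgg : ∀ a b, SameTop k g g' (Icc a b))
    (H : ∀ j' ∈ uIcc j l, ∀ l' ∈ uIcc j l, f j ≤ f j' → g l ≤ g l' → j' ≠ j ∨ l' ≠ l →
      IsContest k f g j' l' → (g l' < f j' → g' l' < f' j') ∧ (f j' < g l' → f' j' < g' l')) :
    IsContest k f' g' j l := by
  refine ⟨?_, h.lt_of_lt hg hd hff hgg fun j' hj' l' hl' hj hl hne hc =>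
    (H j' hj' l' hl' hj hl hne hc).1, ?_⟩
  · have hff := hff (j ⊓ l) (j ⊔ l) j left_mem_uIcc
    have hgg := hgg (j ⊓ l) (j ⊔ l) l right_mem_uIcc
    have h1 := h.1
    rw [uIcc] at h1 ⊢
    omega
  · rw [uIcc_comm] at H ⊢
    exact h.symm.lt_of_lt hf (fun l j => (hd j l).symm) hgg hff fun l' hl' j' hj' hl hj hne hc =>
      (H j' hj' l' hl' hj hl hne.symm hc.symm).2

/-- The key of a pair of columns: contests between larger entries of the rows `f` and `g` have
smaller keys. -/
def contestKey (f g : Fin n → β) (i : Fin n × Fin n) : ℕ :=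
  rankIn f univ i.1 + rankIn g univ i.2

lemma contestKey_lt {f g f' g' : Fin n → β} {j l j' l' : Fin n} (h : IsContest k f g j l)
    (hf : Function.Injective f) (hg : Function.Injective g)
    (hff : ∀ a b, SameTop k f f' (Icc a b)) (hgg : ∀ a b, SameTop k g g' (Icc a b))
    (hj' : j' ∈ uIcc j l) (hl' : l' ∈ uIcc j l) (hj : f j ≤ f j') (hl : g l ≤ g l')
    (hne : j' ≠ j ∨ l' ≠ l) : contestKey f' g' (j', l') < contestKey f' g' (j, l) := by
  have h1 := h.1
  have hff : SameTop k f f' (uIcc j l) := hff (j ⊓ l) (j ⊔ l)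
  have hgg : SameTop k g g' (uIcc j l) := hgg (j ⊓ l) (j ⊔ l)
  have hjk : rankIn f (uIcc j l) j < k := by omega
  have hlk : rankIn g (uIcc j l) l < k := by omega
  have hj2 := hff.le_of_le hf hj' left_mem_uIcc ((rankIn_anti hj).trans_lt hjk) hj
  have hl2 := hgg.le_of_le hg hl' right_mem_uIcc ((rankIn_anti hl).trans_lt hlk) hl
  have hj3 : rankIn f' univ j' ≤ rankIn f' univ j := rankIn_anti hj2
  have hl3 : rankIn g' univ l' ≤ rankIn g' univ l := rankIn_anti hl2
  simp only [contestKey]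
  rcases hne with hne | hne
  · have hlt : f j < f j' := hj.lt_of_ne fun h => hne (hf h).symm
    have := rankIn_lt (mem_univ j') (hff.lt_of_gt left_mem_uIcc hj' hjk hlt)
    omega
  · have hlt : g l < g l' := hl.lt_of_ne fun h => hne (hg h).symm
    have := rankIn_lt (mem_univ l') (hgg.lt_of_gt right_mem_uIcc hl' hlk hlt)
    omega

/-- On top of the Top-`k` lists of two rows of length `n`, which the base point determines,
`4 * n` bits determine the outcomes of all contests. The contests are decided in decreasing order
of the entries. A contest whose outcome is open is charged to its winner and to the side on which
the loser lies; the winner is charged only once on that side, since beating the farther of two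
losers implies beating the nearer one. -/
theorem exists_contest_encoding {X Y : Type*} (k : ℕ) (F G : X → Fin n → β)
    (hF : ∀ x, Function.Injective (F x)) (hG : ∀ x, Function.Injective (G x))
    (hd : ∀ x j l, F x j ≠ G x l) (base : X → Y)
    (hFF : ∀ x x', base x = base x' → ∀ a b, SameTop k (F x) (F x') (Icc a b))
    (hGG : ∀ x x', base x = base x' → ∀ a b, SameTop k (G x) (G x') (Icc a b)) :
    ∃ enc : X → (Fin (4 * n) → Bool), ∀ x x', base x = base x' → enc x = enc x' →
      ∀ j l, IsContest k (F x) (G x) j l → (G x l < F x j ↔ G x' l < F x' j) := by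
  classical
  rcases isEmpty_or_nonempty X with hX | hX
  · exact ⟨isEmptyElim, isEmptyElim⟩
  -- The order in which the contests are decided is read off a representative of the base point.
  let F₀ : Y → Fin n → β := fun y => F (Function.invFun base y)
  let G₀ : Y → Fin n → β := fun y => G (Function.invFun base y)
  have hF₀ : ∀ x a b, SameTop k (F x) (F₀ (base x)) (Icc a b) := fun x =>
    hFF _ _ (Function.invFun_eq ⟨x, rfl⟩).symm
  have hG₀ : ∀ x a b, SameTop k (G x) (G₀ (base x)) (Icc a b) := fun x =>
    hGG _ _ (Function.invFun_eq ⟨x, rfl⟩).symm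
  let c : Fin n × Fin n → X → Prop := fun i x =>
    IsContest k (F x) (G x) i.1 i.2 ∧ G x i.2 < F x i.1
  let key : Y → Fin n × Fin n → ℕ := fun y => contestKey (F₀ y) (G₀ y)
  have hcontest : ∀ t x x' i, base x = base x' → key (base x) i = t →
      (∀ i', key (base x) i' < t → (c i' x ↔ c i' x')) →
      IsContest k (F x) (G x) i.1 i.2 → IsContest k (F x') (G x') i.1 i.2 := by
    intro t
    induction t using Nat.strong_induction_on with
    | _ t ih =>
      rintro x x' ⟨j, l⟩ hbase rfl hpast h
      refine h.transfer (hF x) (hG x) (hd x) (hFF x x' hbase) (hGG x x' hbase)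
        fun j' hj' l' hl' hj hl hne hc => ?_
      have hkey : key (base x) (j', l') < key (base x) (j, l) :=
        contestKey_lt h (hF x) (hG x) (hF₀ x) (hG₀ x) hj' hl' hj hl hne
      have hc' := ih _ hkey x x' (j', l') hbase rfl (fun i' hi' => hpast i' (hi'.trans hkey)) hc
      refine ⟨fun hlt => ((hpast _ hkey).1 ⟨hc, hlt⟩).2, fun hlt => ?_⟩
      refine (lt_or_gt_of_ne (hd x' j' l')).resolve_right fun hgt => ?_
      exact lt_asymm hlt ((hpast _ hkey).2 ⟨hc', hgt⟩).2
  have hbranch : ∀ x i, Branches base key c x i → IsContest k (F x) (G x) i.1 i.2 := by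
    rintro x i ⟨x', hbase, hpast, hne⟩
    by_contra h
    refine hne ⟨fun hc => absurd ?_ h, fun hc => absurd hc.1 h⟩
    exact hcontest _ x' x i hbase rfl (fun i' hi' => hpast i' (hbase ▸ hi')) hc.1
  -- A win over the farther of two entries of `G` settles the comparison with the nearer one.
  have hleft : ∀ x j l m, Branches base key c x (j, l) → c (j, l) x →
      c (j, m) x → l ∈ uIcc j m → l = m := by
    rintro x j l m ⟨x', hbase, hpast, hne⟩ hcl hcm hl
    by_contra hlm
    have hlt : G x l < G x m := by
      refine (lt_or_gt_of_ne fun h => hlm (hG x h)).resolve_right fun hgt => ?_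
      exact lt_asymm hcl.2 (hcm.1.2.2 l hl hgt)
    have hmk : rankIn (G x) (uIcc j m) m < k := by
      have := hcm.1.1
      simp only at this
      omega
    have hkey : key (base x) (j, m) < key (base x) (j, l) := by
      have := rankIn_lt (mem_univ m) ((hG₀ x (j ⊓ m) (j ⊔ m)).lt_of_lt right_mem_uIcc hl hmk hlt)
      simp only [key, contestKey]
      omega
    have hlt' : G x' l < G x' m :=
      (hGG x x' hbase.symm (j ⊓ m) (j ⊔ m)).lt_of_lt right_mem_uIcc hl hmk hlt
    have hcl' : IsContest k (F x') (G x') j l := hcontest _ x x' (j, l) hbase.symm rfl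
      (fun i' hi' => (hpast i' hi').symm) hcl.1
    exact hne ⟨fun _ => hcl, fun _ => ⟨hcl', hlt'.trans ((hpast _ hkey).2 hcm).2⟩⟩
  -- The same for two entries of `F`.
  have hright : ∀ x l j m, Branches base key c x (j, l) → Branches base key c x (m, l) →
      ¬ c (j, l) x → ¬ c (m, l) x → j ∈ uIcc m l → j = m := by
    rintro x l j m hbj hbm hcj hcm hj
    have hconj := hbranch x _ hbj
    have hconm := hbranch x _ hbm
    obtain ⟨x', hbase, hpast, hne⟩ := hbj
    have hltj : F x j < G x l :=
      (lt_or_gt_of_ne (hd x j l)).resolve_right fun h => hcj ⟨hconj, h⟩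
    have hltm : F x m < G x l :=
      (lt_or_gt_of_ne (hd x m l)).resolve_right fun h => hcm ⟨hconm, h⟩
    by_contra hjm
    have hlt : F x j < F x m := by
      refine (lt_or_gt_of_ne fun h => hjm (hF x h)).resolve_right fun hgt => ?_
      exact lt_asymm hltj (hconm.2.1 j hj hgt)
    have hmk : rankIn (F x) (uIcc m l) m < k := by
      have := hconm.1
      simp only at this
      omega
    have hkey : key (base x) (m, l) < key (base x) (j, l) := by
      have := rankIn_lt (mem_univ m) ((hF₀ x (m ⊓ l) (m ⊔ l)).lt_of_lt left_mem_uIcc hj hmk hlt)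
      simp only [key, contestKey]
      omega
    have hlt' : F x' j < F x' m :=
      (hFF x x' hbase.symm (m ⊓ l) (m ⊔ l)).lt_of_lt left_mem_uIcc hj hmk hlt
    have hconm' : IsContest k (F x') (G x') m l := hcontest _ x x' (m, l) hbase.symm rfl
      (fun i' hi' => (hpast i' (hi'.trans hkey)).symm) hconm
    refine hne ⟨fun h => absurd ?_ hcm, fun h => absurd h hcj⟩
    exact (hpast _ hkey).1 ⟨hconm', h.2.trans hlt'⟩
  obtain ⟨enc, henc⟩ := exists_encoding_of_card_branches_le base key c (4 * n) fun x => by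
    let φ : Fin n × Fin n → Bool × Bool × Fin n := fun i =>
      (decide (c i x), decide (i.1 ≤ i.2), if c i x then i.1 else i.2)
    have hφ : Set.InjOn φ {i | Branches base key c x i} := by
      rintro ⟨j, l⟩ hi ⟨j', l'⟩ hi' h
      simp only [Set.mem_ofPred_eq] at hi hi'
      simp only [φ, Prod.mk.injEq, decide_eq_decide] at h
      obtain ⟨h1, h2, h3⟩ := h
      by_cases hc : c (j, l) x
      · have hc' := h1.1 hc
        rw [if_pos hc, if_pos hc'] at h3
        subst h3
        have : l ∈ uIcc j l' ∨ l' ∈ uIcc j l := by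
          simp only [mem_uIcc']
          omega
        rcases this with h | h
        · rw [hleft x j l l' hi hc hc' h]
        · rw [hleft x j l' l hi' hc' hc h]
      · have hc' := fun h => hc (h1.2 h)
        rw [if_neg hc, if_neg hc'] at h3
        subst h3
        have : j ∈ uIcc j' l ∨ j' ∈ uIcc j l := by
          simp only [mem_uIcc']
          omega
        rcases this with h | h
        · rw [hright x l j j' hi hi' hc hc' h]
        · rw [hright x l j' j hi' hi hc' hc h]
    rw [← hφ.ncard_image]
    refine (Set.ncard_le_card _).trans ?_
    simp
    omega
  refine ⟨enc, fun x x' hbase hx j l hcon => ?_⟩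
  have hc := henc x x' hbase hx
  exact ⟨fun h => ((hc (j, l)).1 ⟨hcon, h⟩).2, fun h =>
    ((hc (j, l)).2 ⟨hcontest _ x x' (j, l) hbase rfl (fun i' _ => hc i') hcon, h⟩).2⟩

end Contest

/-! ### Counting the Top-`k` structures of one row -/

section Row

variable {β : Type*} [LinearOrder β] {n : ℕ}

/-- The number of positions strictly between `i` and `t` whose entries exceed `f i`. -/
def laterRank (f : Fin n → β) (i : Fin n) (t : ℕ) : ℕ :=
  #{i' : Fin n | i < i' ∧ (i' : ℕ) < t ∧ f i < f i'}

/-- The number of entries before position `j` that are smaller than `f j` and still active, that is,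
among the `k` largest entries of the range from their own position to `j - 1`. -/
def overtakes (k : ℕ) (f : Fin n → β) (j : Fin n) : ℕ :=
  #{i : Fin n | i < j ∧ laterRank f i j < k ∧ f i < f j}

lemma laterRank_mono (f : Fin n → β) (i : Fin n) {s t : ℕ} (h : s ≤ t) :
    laterRank f i s ≤ laterRank f i t :=
  card_le_card fun x hx => by
    simp only [mem_filter, mem_univ, true_and] at hx ⊢
    exact ⟨hx.1, hx.2.1.trans_le h, hx.2.2⟩

lemma laterRank_lt {f : Fin n → β} {i j : Fin n} {t : ℕ} (hij : i < j) (hj : (j : ℕ) < t)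
    (hf : f i < f j) : laterRank f i j < laterRank f i t :=
  card_lt_card <| (ssubset_iff_of_subset fun x hx => by
    simp only [mem_filter, mem_univ, true_and] at hx ⊢
    exact ⟨hx.1, hx.2.1.trans hj, hx.2.2⟩).2 ⟨j, by simp [hij, hj, hf]⟩

lemma laterRank_succ {f : Fin n → β} {i j : Fin n} (hij : i < j) :
    laterRank f i (j + 1) = laterRank f i j + if f i < f j then 1 else 0 := by
  split_ifs with h
  · have : univ.filter (fun i' : Fin n => i < i' ∧ (i' : ℕ) < j + 1 ∧ f i < f i') =
        insert j (univ.filter fun i' : Fin n => i < i' ∧ (i' : ℕ) < j ∧ f i < f i') := by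
      ext x
      simp only [mem_filter, mem_univ, true_and, mem_insert]
      constructor
      · rintro ⟨h1, h2, h3⟩
        by_cases hx : x = j
        · exact Or.inl hx
        · exact Or.inr ⟨h1, by omega, h3⟩
      · rintro (rfl | ⟨h1, h2, h3⟩)
        · exact ⟨hij, by omega, h⟩
        · exact ⟨h1, by omega, h3⟩
    rw [laterRank, this, card_insert_of_notMem (by simp), laterRank]
  · refine congrArg card (filter_congr fun x _ => ?_)
    refine and_congr_right fun _ => ⟨fun hx => ⟨?_, hx.2⟩, fun hx => ⟨by omega, hx.2⟩⟩
    have : x ≠ j := by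
      rintro rfl
      exact h hx.2
    omega

lemma laterRank_self (f : Fin n → β) (j : Fin n) : laterRank f j (j + 1) = 0 := by
  rw [laterRank, card_eq_zero, filter_eq_empty_iff]
  rintro x - ⟨h1, h2, -⟩
  omega

/-- An entry is overtaken at most `k` times while it is active. -/
lemma sum_overtakes_le (k : ℕ) (f : Fin n → β) : ∑ j, overtakes k f j ≤ k * n := by
  have h := sum_card_bipartiteAbove_eq_sum_card_bipartiteBelow (s := (univ : Finset (Fin n)))
    (t := univ) fun i j : Fin n => i < j ∧ laterRank f i j < k ∧ f i < f j
  simp only [bipartiteAbove, bipartiteBelow] at h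
  simp only [overtakes]
  rw [← h]
  refine (sum_le_card_nsmul _ _ k fun i _ => ?_).trans (by simp [mul_comm])
  rw [← card_range k]
  refine card_le_card_of_injOn (fun j => laterRank f i j) (fun j hj => ?_) ?_
  · simpa using (mem_filter.1 hj).2.2.1
  · intro j hj j' hj' heq
    simp only [coe_filter, mem_univ, true_and, Set.mem_ofPred_eq] at hj hj' heq
    rcases lt_trichotomy j j' with h | h | h
    · exact absurd heq (laterRank_lt hj.1 h hj.2.2).ne
    · exact h
    · exact absurd heq (laterRank_lt hj'.1 h hj'.2.2).ne'

/-- Reading the row from left to right, the numbers `overtakes` determine which entries are active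
and how the active entries compare: they tell where the next entry is inserted into the sorted list
of the active ones. -/
lemma active_of_overtakes_eq {k : ℕ} {f f' : Fin n → β} (hf : Function.Injective f)
    (hf' : Function.Injective f') (h : overtakes k f = overtakes k f') (t : ℕ) (ht : t ≤ n) :
    (∀ i : Fin n, (i : ℕ) < t → min (laterRank f i t) k = min (laterRank f' i t) k) ∧
      ∀ i j : Fin n, (i : ℕ) < t → (j : ℕ) < t → laterRank f i t < k → laterRank f j t < k →
        (f i < f j ↔ f' i < f' j) := by
  induction t with
  | zero => simp
  | succ t ih =>
    obtain ⟨ih1, ih2⟩ := ih (by omega)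
    obtain ⟨s, rfl⟩ : ∃ s : Fin n, (s : ℕ) = t := ⟨⟨t, ht⟩, rfl⟩
    -- Two lower sets of the same size in the sorted list of active entries coincide.
    have hset : univ.filter (fun i : Fin n => i < s ∧ laterRank f i s < k ∧ f i < f s) =
        univ.filter fun i : Fin n => i < s ∧ laterRank f' i s < k ∧ f' i < f' s := by
      have hcard := congrFun h s
      simp only [overtakes] at hcard
      by_contra hne
      have h1 : ∃ i, (i < s ∧ laterRank f i s < k ∧ f i < f s) ∧ ¬ f' i < f' s := by
        by_contra! hcon
        refine hne (eq_of_subset_of_card_le (fun i hi => ?_) hcard.ge)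
        simp only [mem_filter, mem_univ, true_and] at hi ⊢
        have := ih1 i hi.1
        exact ⟨hi.1, by omega, hcon i hi⟩
      have h2 : ∃ i, (i < s ∧ laterRank f' i s < k ∧ f' i < f' s) ∧ ¬ f i < f s := by
        by_contra! hcon
        refine hne (eq_of_subset_of_card_le (fun i hi => ?_) hcard.le).symm
        simp only [mem_filter, mem_univ, true_and] at hi ⊢
        have := ih1 i hi.1
        exact ⟨hi.1, by omega, hcon i hi⟩
      obtain ⟨i, ⟨his, hik, hi⟩, hi'⟩ := h1
      obtain ⟨j, ⟨hjs, hjk, hj'⟩, hj⟩ := h2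
      have := ih1 j hjs
      have h3 := (ih2 i j his hjs hik (by omega)).1 (hi.trans_le (not_lt.1 hj))
      exact lt_asymm h3 (hj'.trans_le (not_lt.1 hi'))
    have hnew : ∀ i : Fin n, i < s → laterRank f i s < k → (f i < f s ↔ f' i < f' s) := by
      intro i his hik
      have h1 := ih1 i his
      have h2 := Finset.ext_iff.1 hset i
      simp only [mem_filter, mem_univ, true_and, his, hik, show laterRank f' i s < k by omega] at h2
      exact h2
    have hnew' : ∀ i : Fin n, i < s → laterRank f i s < k → (f s < f i ↔ f' s < f' i) := by
      intro i his hik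
      have h1 : f i ≠ f s := fun h => his.ne (hf h)
      have h2 : f' i ≠ f' s := fun h => his.ne (hf' h)
      rw [lt_iff_not_ge, lt_iff_not_ge, h1.le_iff_lt, h2.le_iff_lt, hnew i his hik]
    refine ⟨fun i hi => ?_, fun i j hi hj hik hjk => ?_⟩
    · rcases (Nat.lt_succ_iff.1 hi).lt_or_eq with his | his
      · have h1 := ih1 i his
        rw [laterRank_succ his, laterRank_succ his]
        by_cases hik : laterRank f i s < k
        · have h2 := hnew i his hik
          simp only [h2]
          omega
        · omega
      · obtain rfl : i = s := Fin.ext his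
        rw [laterRank_self, laterRank_self]
    · have hik' := (laterRank_mono f i (Nat.le_succ s)).trans_lt hik
      have hjk' := (laterRank_mono f j (Nat.le_succ s)).trans_lt hjk
      rcases (Nat.lt_succ_iff.1 hi).lt_or_eq with his | his <;>
        rcases (Nat.lt_succ_iff.1 hj).lt_or_eq with hjs | hjs
      · exact ih2 i j his hjs hik' hjk'
      · obtain rfl : j = s := Fin.ext hjs
        exact hnew i his hik'
      · obtain rfl : i = s := Fin.ext his
        exact hnew' j hjs hjk'
      · obtain rfl : i = j := Fin.ext (his.trans hjs.symm)
        simp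

/-- If `f` and `f'` order the positions with property `P` alike, and all Top-`k` positions of either
have it, then the Top-`k` lists coincide. -/
lemma sameTop_of_forall_lt_iff {ι : Type*} {k : ℕ} {f f' : ι → β} {R : Finset ι}
    (hf : Function.Injective f) (hf' : Function.Injective f') (P : ι → Prop)
    (hP : ∀ p ∈ R, rankIn f R p < k → P p) (hP' : ∀ p ∈ R, rankIn f' R p < k → P p)
    (h : ∀ p ∈ R, ∀ q ∈ R, P p → P q → (f p < f q ↔ f' p < f' q)) : SameTop k f f' R := by
  have key : ∀ {g g' : ι → β}, Function.Injective g → Function.Injective g' →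
      (∀ p ∈ R, rankIn g R p < k → P p) → (∀ p ∈ R, rankIn g' R p < k → P p) →
      (∀ p ∈ R, ∀ q ∈ R, P p → P q → (g p < g q ↔ g' p < g' q)) →
      ∀ p ∈ R, rankIn g R p < k → ∀ q ∈ R, g q < g p → g' q < g' p := by
    intro g g' hg hg' hP hP' h p hp hk q hq hlt
    by_contra hcon
    have hlt' : g' p < g' q := (not_lt.1 hcon).lt_of_ne fun h => by
      rw [hg' h] at hlt
      exact lt_irrefl _ hlt
    -- The largest `g'`-entry in the wrong order with `p` also has small rank.
    obtain ⟨m, hm, hmax⟩ := exists_max_image {x ∈ R | g x < g p ∧ g' p < g' x} g'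
      ⟨q, mem_filter.2 ⟨hq, hlt, hlt'⟩⟩
    rw [mem_filter] at hm
    have hrank : rankIn g' R m ≤ rankIn g R p := card_le_card fun x hx => by
      rw [mem_filter] at hx ⊢
      have hpx := hm.2.2.trans hx.2
      refine ⟨hx.1, lt_of_not_ge fun hle => ?_⟩
      rcases hle.lt_or_eq with hltx | heq
      · exact hx.2.not_ge (hmax x (mem_filter.2 ⟨hx.1, hltx, hpx⟩))
      · rw [hg heq] at hpx
        exact lt_irrefl _ hpx
    exact lt_asymm hm.2.2 ((h m hm.1 p hp (hP' m hm.1 (hrank.trans_lt hk)) (hP p hp hk)).1 hm.2.1)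
  exact sameTop_of_lt_imp hf hf' (key hf hf' hP hP' h)
    (key hf' hf hP' hP fun p hp q hq h1 h2 => (h p hp q hq h1 h2).symm)

theorem sameTop_of_overtakes_eq {k : ℕ} {f f' : Fin n → β} (hf : Function.Injective f)
    (hf' : Function.Injective f') (h : overtakes k f = overtakes k f') (a b : Fin n) :
    SameTop k f f' (Icc a b) := by
  obtain ⟨h1, h2⟩ := active_of_overtakes_eq hf hf' h (b + 1) b.2
  have hle : ∀ (g : Fin n → β), ∀ p ∈ Icc a b, laterRank g p (b + 1) ≤ rankIn g (Icc a b) p := by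
    intro g p hp
    refine card_le_card fun x hx => ?_
    simp only [mem_filter, mem_univ, true_and, mem_Icc] at hx hp ⊢
    exact ⟨by omega, hx.2.2⟩
  have hlt : ∀ p ∈ Icc a b, (p : ℕ) < b + 1 := fun p hp => by
    have := (mem_Icc.1 hp).2
    omega
  refine sameTop_of_forall_lt_iff hf hf' (fun p => laterRank f p (b + 1) < k)
    (fun p hp hk => (hle f p hp).trans_lt hk) (fun p hp hk => ?_)
    fun p hp q hq => h2 p q (hlt p hp) (hlt q hq)
  have h3 := h1 p (hlt p hp)
  have h4 := hle f' p hp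
  omega

/-- A row of length `n` has at most `((k + 1) * n).choose n` Top-`k` structures: it is described by
`n` natural numbers of sum at most `k * n`. -/
theorem exists_row_code {α : Type*} [LinearOrder α] (n k : ℕ) :
    ∃ τ : (Fin n → α) → Sym (Option (Fin n)) (k * n), ∀ A A', τ A = τ A' →
      topK2Sided n k A = topK2Sided n k A' := by
  -- The component at `none` fills the sum up to `k * n`.
  let w : (Fin n → α) → {P : Option (Fin n) → ℕ // ∑ i, P i = k * n} := fun A =>
    ⟨fun o => o.elim (k * n - ∑ j, overtakes k (tagged A) j) (overtakes k (tagged A)), by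
      rw [Fintype.sum_option]
      exact Nat.sub_add_cancel (sum_overtakes_le k _)⟩
  refine ⟨fun A => (Sym.equivNatSumOfFintype _ _).symm (w A), fun A A' h => ?_⟩
  have hw : w A = w A' := (Sym.equivNatSumOfFintype _ _).symm.injective h
  have hd : overtakes k (tagged A) = overtakes k (tagged A') :=
    funext fun j => congrFun (congrArg Subtype.val hw) (some j)
  funext q
  exact (topK_eq_topK_iff k A A' _).2
    (sameTop_of_overtakes_eq (tagged_injective A) (tagged_injective A') hd _ _)

lemma card_sym_option_fin (n k : ℕ) :
    Fintype.card (Sym (Option (Fin n)) (k * n)) = ((k + 1) * n).choose n := by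
  rw [Sym.card_sym_eq_choose, Fintype.card_option, Fintype.card_fin]
  rw [show n + 1 + k * n - 1 = (k + 1) * n by rw [add_mul]; omega]
  exact Nat.choose_symm_of_eq_add (by ring)

end Row

/-! ### Encoding two-dimensional arrays -/

lemma hasEncoding_of_card_le {X Q R γ : Type*} [Fintype γ] [Nonempty R] {answer : X → Q → R}
    (code : X → γ) (hcode : ∀ x x', code x = code x' → answer x = answer x') {b : ℕ}
    (hb : Fintype.card γ ≤ 2 ^ b) : HasEncoding answer b := by
  classical
  obtain ⟨e⟩ := Function.Embedding.nonempty_of_card_le (α := γ) (β := Fin b → Bool) (by simpa)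
  refine ⟨fun x => e (code x), fun s q =>
    if h : ∃ x, e (code x) = s then answer h.choose q else Classical.arbitrary R, fun x q => ?_⟩
  have h : ∃ x', e (code x') = e (code x) := ⟨x, rfl⟩
  simp only [dif_pos h]
  rw [hcode _ _ (e.injective h.choose_spec)]

section Array

variable {α : Type*} {m n k : ℕ}

/-- Row `u` of the array `A`, its entries made distinct by appending their positions in `A`. -/
def taggedRow (A : Fin m → Fin n → α) (u : Fin m) (j : Fin n) : α ×ₗ (Fin m ×ₗ Fin n) :=
  tagged (fun p : Fin m ×ₗ Fin n => A (ofLex p).1 (ofLex p).2) (toLex (u, j))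

lemma taggedRow_injective (A : Fin m → Fin n → α) (u : Fin m) :
    Function.Injective (taggedRow A u) := fun j j' h => by
  simpa using tagged_injective _ h

lemma taggedRow_ne (A : Fin m → Fin n → α) {u v : Fin m} (huv : u ≠ v) (j l : Fin n) :
    taggedRow A u j ≠ taggedRow A v l := fun h => by
  have := tagged_injective _ h
  simp [huv] at this

variable [LinearOrder α]

lemma taggedRow_lt_iff (A : Fin m → Fin n → α) (u : Fin m) (j j' : Fin n) :
    taggedRow A u j < taggedRow A u j' ↔ tagged (A u) j < tagged (A u) j' := by
  simp [taggedRow, tagged, Prod.Lex.toLex_lt_toLex]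

lemma sameTop_taggedRow {A A' : Fin m → Fin n → α} {u : Fin m}
    (h : topK2Sided n k (A u) = topK2Sided n k (A' u)) (a b : Fin n) :
    SameTop k (taggedRow A u) (taggedRow A' u) (Icc a b) := by
  have h1 := (topK_eq_topK_iff k (A u) (A' u) (Icc a b)).1 (congrFun h (a, b))
  have hrank : ∀ (A : Fin m → Fin n → α) p,
      rankIn (taggedRow A u) (Icc a b) p = rankIn (tagged (A u)) (Icc a b) p := fun A p =>
    congrArg card (filter_congr fun q _ => taggedRow_lt_iff A u p q)
  intro p hp
  rw [hrank, hrank]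
  exact h1 p hp

/-- The Top-`k` lists of the rows and the outcomes of the contests between rows determine which
entries lie below a Top-`k` entry of a 4-sided range. -/
lemma lt_of_contests {A A' : Fin m → Fin n → α}
    (hrow : ∀ u, topK2Sided n k (A u) = topK2Sided n k (A' u))
    (hcon : ∀ u v, u ≠ v → ∀ j l, IsContest k (taggedRow A u) (taggedRow A v) j l →
      taggedRow A v l < taggedRow A u j → taggedRow A' v l < taggedRow A' u j)
    {s : Finset (Fin m)} {a b : Fin n} {u v : Fin m} {j l : Fin n} (hu : u ∈ s) (hv : v ∈ s)
    (hj : j ∈ Icc a b) (hl : l ∈ Icc a b)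
    (hk : #{p ∈ s ×ˢ Icc a b | taggedRow A u j < taggedRow A p.1 p.2} < k)
    (hlt : taggedRow A v l < taggedRow A u j) : taggedRow A' v l < taggedRow A' u j := by
  by_cases huv : u = v
  · subst huv
    refine (sameTop_taggedRow (hrow u) a b).lt_of_lt hj hl (lt_of_le_of_lt ?_ hk) hlt
    refine card_le_card_of_injOn (fun i => (u, i)) (fun i hi => ?_) fun i _ i' _ h => by simpa using h
    simp only [coe_filter, Set.mem_ofPred_eq, mem_product] at hi ⊢
    exact ⟨⟨hu, hi.1⟩, hi.2⟩
  · obtain ⟨x, hx, hlx, hxj, hxk, hc⟩ := exists_isContest (k := k) (taggedRow_ne A huv) hj hl hlt <| by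
      refine lt_of_le_of_lt ?_ hk
      let above : Finset (Fin n) := {i ∈ Icc a b | taggedRow A u j < taggedRow A u i}
      let above' : Finset (Fin n) := {i ∈ Icc a b | taggedRow A u j < taggedRow A v i}
      have hdisj : Disjoint (({u} : Finset (Fin m)) ×ˢ above) ({v} ×ˢ above') := by
        rw [disjoint_product]
        exact Or.inl (by simpa using huv)
      have hcard : #(({u} : Finset (Fin m)) ×ˢ above ∪ {v} ×ˢ above') = #above + #above' := by
        rw [card_union_of_disjoint hdisj, card_product, card_product, card_singleton,
          card_singleton, one_mul, one_mul]
      refine hcard.ge.trans (card_le_card fun p hp => ?_)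
      simp only [above, above', mem_union, mem_product, mem_singleton, mem_filter] at hp ⊢
      rcases hp with ⟨rfl, h1, h2⟩ | ⟨rfl, h1, h2⟩
      · exact ⟨⟨hu, h1⟩, h2⟩
      · exact ⟨⟨hv, h1⟩, h2⟩
    exact ((sameTop_taggedRow (hrow v) a b).le_of_le (taggedRow_injective A v) hx hl hxk
      hlx).trans_lt (hcon u v huv j x hc hxj)

theorem topK4Sided_eq_of_contests {A A' : Fin m → Fin n → α}
    (hrow : ∀ u, topK2Sided n k (A u) = topK2Sided n k (A' u))
    (hcon : ∀ u v, u ≠ v → ∀ j l, IsContest k (taggedRow A u) (taggedRow A v) j l →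
      taggedRow A v l < taggedRow A u j → taggedRow A' v l < taggedRow A' u j)
    (hcon' : ∀ u v, u ≠ v → ∀ j l, IsContest k (taggedRow A' u) (taggedRow A' v) j l →
      taggedRow A' v l < taggedRow A' u j → taggedRow A v l < taggedRow A u j) :
    topK4Sided m n k A = topK4Sided m n k A' := by
  funext q
  refine congrArg (List.map ofLex) ((topK_eq_topK_iff k _ _ _).2 ?_)
  have hrank : ∀ (A : Fin m → Fin n → α) (p : Fin m ×ₗ Fin n),
      #{x ∈ Icc q.1.1 q.1.2 ×ˢ Icc q.2.1 q.2.2 |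
        taggedRow A (ofLex p).1 (ofLex p).2 < taggedRow A x.1 x.2} =
      rankIn (tagged fun p : Fin m ×ₗ Fin n => A (ofLex p).1 (ofLex p).2)
        ((Icc q.1.1 q.1.2 ×ˢ Icc q.2.1 q.2.2).image toLex) p := by
    intro A p
    rw [rankIn, filter_image, card_image_of_injective _ toLex.injective]
    rfl
  have hmem : ∀ p : Fin m ×ₗ Fin n, p ∈ (Icc q.1.1 q.1.2 ×ˢ Icc q.2.1 q.2.2).image toLex →
      (ofLex p).1 ∈ Icc q.1.1 q.1.2 ∧ (ofLex p).2 ∈ Icc q.2.1 q.2.2 := by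
    intro p hp
    obtain ⟨x, hx, rfl⟩ := mem_image.1 hp
    exact mem_product.1 hx
  refine sameTop_of_lt_imp (tagged_injective _) (tagged_injective _)
    (fun p hp hk x hx hlt => ?_) fun p hp hk x hx hlt => ?_
  · rw [← hrank] at hk
    exact lt_of_contests hrow hcon (hmem p hp).1 (hmem x hx).1 (hmem p hp).2 (hmem x hx).2 hk hlt
  · rw [← hrank] at hk
    exact lt_of_contests (fun u => (hrow u).symm) hcon' (hmem p hp).1 (hmem x hx).1 (hmem p hp).2
      (hmem x hx).2 hk hlt

/-- Row codes, one for each row, together with `4 * n` bits for each pair of rows form a code of the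
array. -/
theorem exists_array_code {D : Type*} (τ : (Fin n → α) → D)
    (hτ : ∀ B B', τ B = τ B' → topK2Sided n k B = topK2Sided n k B') :
    ∃ code : (Fin m → Fin n → α) →
        (Fin m → D) × ((Σ v : Fin m, Fin v) → Fin (4 * n) → Bool),
      ∀ A A', code A = code A' → topK4Sided m n k A = topK4Sided m n k A' := by
  have hpair : ∀ u v : Fin m, u ≠ v → ∃ enc : (Fin m → Fin n → α) → (Fin (4 * n) → Bool),
      ∀ A A', (τ (A u), τ (A v)) = (τ (A' u), τ (A' v)) → enc A = enc A' →
      ∀ j l, IsContest k (taggedRow A u) (taggedRow A v) j l →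
        (taggedRow A v l < taggedRow A u j ↔ taggedRow A' v l < taggedRow A' u j) := by
    intro u v huv
    refine exists_contest_encoding k (fun A => taggedRow A u) (fun A => taggedRow A v)
      (fun A => taggedRow_injective A u) (fun A => taggedRow_injective A v)
      (fun A => taggedRow_ne A huv) (fun A => (τ (A u), τ (A v)))
      (fun A A' h => sameTop_taggedRow (hτ _ _ (congrArg Prod.fst h)))
      (fun A A' h => sameTop_taggedRow (hτ _ _ (congrArg Prod.snd h)))
  choose! enc henc using hpair
  let fst : (Σ v : Fin m, Fin v) → Fin m := fun i => i.2.castLE i.1.2.le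
  have hfst : ∀ i, fst i ≠ i.1 := fun i h => by
    have h1 : (i.2 : ℕ) = i.1 := congrArg Fin.val h
    exact i.2.2.ne h1
  let code : (Fin m → Fin n → α) →
      (Fin m → D) × ((Σ v : Fin m, Fin v) → Fin (4 * n) → Bool) := fun A =>
    (fun u => τ (A u), fun i => enc (fst i) i.1 A)
  have hcode : ∀ A A', code A = code A' → ∀ u v, u ≠ v → ∀ j l,
      IsContest k (taggedRow A u) (taggedRow A v) j l →
      taggedRow A v l < taggedRow A u j → taggedRow A' v l < taggedRow A' u j := by
    intro A A' h u v huv j l hc hlt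
    have hrow : ∀ u, τ (A u) = τ (A' u) := congrFun (congrArg Prod.fst h)
    have hbits : ∀ i, enc (fst i) i.1 A = enc (fst i) i.1 A' := congrFun (congrArg Prod.snd h)
    rcases lt_or_gt_of_ne huv with hlt' | hlt'
    · exact (henc u v huv A A' (by rw [hrow, hrow]) (hbits ⟨v, u, hlt'⟩) j l hc).1 hlt
    · have h1 := henc v u huv.symm A A' (by rw [hrow, hrow]) (hbits ⟨u, v, hlt'⟩) l j hc.symm
      refine (lt_or_gt_of_ne (taggedRow_ne A' huv j l)).resolve_left fun h2 => ?_
      exact lt_asymm hlt (h1.2 h2)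
  exact ⟨code, fun A A' h => topK4Sided_eq_of_contests
    (fun u => hτ _ _ (congrFun (congrArg Prod.fst h) u)) (hcode A A' h) (hcode A' A h.symm)⟩

lemma card_array_code (D : Type*) [Fintype D] (m n : ℕ) :
    Fintype.card ((Fin m → D) × ((Σ v : Fin m, Fin v) → Fin (4 * n) → Bool)) =
      Fintype.card D ^ m * 2 ^ (2 * n * m * (m - 1)) := by
  have hpairs : Fintype.card (Σ v : Fin m, Fin v) * 2 = m * (m - 1) := by
    rw [Fintype.card_sigma]
    simp only [Fintype.card_fin]
    rw [Fin.sum_univ_eq_sum_range (fun i => i), sum_range_id_mul_two]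
  rw [Fintype.card_prod, Fintype.card_fun, Fintype.card_fun, Fintype.card_fun, Fintype.card_fin,
    Fintype.card_fin, Fintype.card_bool, ← pow_mul]
  congr 2
  calc 4 * n * Fintype.card (Σ v : Fin m, Fin v)
      = 2 * n * (Fintype.card (Σ v : Fin m, Fin v) * 2) := by ring
    _ = 2 * n * m * (m - 1) := by rw [hpairs]; ring

end Array

theorem mainTheorem2 :
    (∀ (α : Type*) [LinearOrder α] (m n k S : ℕ),
      HasEncoding (topK2Sided (α := α) n k) S →
        HasEncoding (topK4Sided (α := α) m n k) (m * S + 2 * n * m * (m - 1))) ∧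
    (∃ ρ : ℕ → ℝ, Asymptotics.IsLittleO Filter.atTop ρ (fun n : ℕ => (n : ℝ)) ∧
      ∀ (α : Type*) [LinearOrder α] (m n k : ℕ), ∃ b : ℕ,
        (b : ℝ) ≤ m * Real.logb 2 (((k + 1) * n).choose n) + 2 * n * m * ((m : ℝ) - 1) + ρ n ∧
        HasEncoding (topK4Sided (α := α) m n k) b) := by
  refine ⟨fun α _ m n k S ⟨enc, dec, h⟩ => ?_, fun _ => 1, ?_, fun α _ m n k => ?_⟩
  · obtain ⟨code, hcode⟩ := exists_array_code (m := m) (k := k) enc fun B B' hB => funext fun q => by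
      rw [← h, ← h, hB]
    refine hasEncoding_of_card_le code hcode ?_
    rw [card_array_code, Fintype.card_fun, Fintype.card_bool, Fintype.card_fin, ← pow_mul,
      ← pow_add, mul_comm S m]
  · exact Asymptotics.isLittleO_const_left.2
      (Or.inr (tendsto_norm_atTop_atTop.comp tendsto_natCast_atTop_atTop))
  · obtain ⟨τ, hτ⟩ := exists_row_code (α := α) n k
    obtain ⟨code, hcode⟩ := exists_array_code (m := m) τ hτ
    have hC : 0 < ((k + 1) * n).choose n := Nat.choose_pos (Nat.le_mul_of_pos_left n k.succ_pos)
    -- A single rounding for the whole array costs less than one bit.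
    refine ⟨Nat.clog 2 (((k + 1) * n).choose n ^ m) + 2 * n * m * (m - 1), ?_,
      hasEncoding_of_card_le code hcode ?_⟩
    · have hlog : (Nat.clog 2 (((k + 1) * n).choose n ^ m) : ℝ) ≤
          m * Real.logb 2 (((k + 1) * n).choose n) + 1 := by
        rw [← Real.natCeil_logb_natCast, ← Real.logb_pow, ← Nat.cast_pow]
        refine (Nat.ceil_lt_add_one (Real.logb_nonneg one_lt_two ?_)).le
        exact_mod_cast Nat.one_le_pow _ _ hC
      have hpairs : ((2 * n * m * (m - 1) : ℕ) : ℝ) = 2 * n * m * ((m : ℝ) - 1) := by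
        cases m <;> simp
      rw [Nat.cast_add, hpairs]
      simp only
      linarith
    · rw [card_array_code, card_sym_option_fin, pow_add]
      exact Nat.mul_le_mul_right _ (Nat.le_pow_clog one_lt_two _)
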